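/- Let $\mathcal M$ be a von Neumann algebra acting on a complex Hilbert space, and let $\mathcal M_*$ be the space of all normal (i.e. $\sigma$-weakly continuous) linear functionals on $\mathcal M$. For $\varphi\in\mathcal M_*$ let $\varphi=u|\varphi|$ be its polar decomposition: $|\varphi|$ is a positive normal functional and $u\in\mathcal M$ is a partial isometry such that $\varphi(y)=|\varphi|(uy)$ for all $y\in\mathcal M$ and $uu^*$ is the support projection of $|\varphi|$, that is, the least projection $p\in\mathcal M$ with $|\varphi|(\mathbf 1-p)=0$. (Such $u$ and $|\varphi|$ exist and are uniquely determined by $\varphi$.) Theorem. A positive element $a$ of $\mathcal M$ belongs to the center of $\mathcal M$ if and only if $|\varphi(a)|\le|\varphi|(a)$ for every $\varphi\in\mathcal M_*$. -/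

import Mathlib

open scoped ComplexOrder

namespace VonNeumannAlgebra

variable {H : Type*} [NormedAddCommGroup H] [InnerProductSpace ℂ H] [CompleteSpace H]
  {M : VonNeumannAlgebra H}

/-- A linear functional on a von Neumann algebra `M ⊆ B(H)` is normal (that is, it belongs to the
predual of `M`; equivalently it is σ-weakly continuous) if it has the form
`x ↦ ∑ₙ ⟨x ξₙ, ηₙ⟩` with `∑ₙ ‖ξₙ‖² < ∞` and `∑ₙ ‖ηₙ‖² < ∞`. -/
def IsNormalFunctional (φ : M.toStarSubalgebra →ₗ[ℂ] ℂ) : Prop :=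
  ∃ ξ η : ℕ → H, Summable (fun n => ‖ξ n‖ ^ 2) ∧ Summable (fun n => ‖η n‖ ^ 2) ∧
    ∀ x : M.toStarSubalgebra, HasSum (fun n => inner ℂ (η n) ((x : H →L[ℂ] H) (ξ n))) (φ x)

/-- A linear functional `φ` on `M` is positive if `φ(x* x) ≥ 0` for all `x ∈ M`
(the order on `ℂ` makes this include that `φ(x* x)` is real). -/
def IsPositiveFunctional (φ : M.toStarSubalgebra →ₗ[ℂ] ℂ) : Prop :=
  ∀ x : M.toStarSubalgebra, 0 ≤ φ (star x * x)

/-- `p` is the support projection of the positive functional `ψ`: the least projection of `M`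
with `ψ(1 - p) = 0`. -/
structure IsSupportProjection (ψ : M.toStarSubalgebra →ₗ[ℂ] ℂ) (p : M.toStarSubalgebra) :
    Prop where
  isStarProjection : IsStarProjection p
  map_one_sub : ψ (1 - p) = 0
  least : ∀ q : M.toStarSubalgebra, IsStarProjection q → ψ (1 - q) = 0 → p * q = p

/-- `φ = u ψ` is the polar decomposition of `φ`. Here `u ψ` is the functional `y ↦ ψ(u y)`,
the functional `ψ` is positive and normal, and `u ∈ M` is a partial isometry such that `u u*` is
the support projection of `ψ`. -/
structure IsPolarDecomposition (φ : M.toStarSubalgebra →ₗ[ℂ] ℂ) (u : M.toStarSubalgebra)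
    (ψ : M.toStarSubalgebra →ₗ[ℂ] ℂ) : Prop where
  normal : IsNormalFunctional ψ
  positive : IsPositiveFunctional ψ
  partialIsometry : u * star u * u = u
  eq_mul : ∀ y : M.toStarSubalgebra, φ y = ψ (u * y)
  support : IsSupportProjection ψ (u * star u)

open Classical in
/-- The absolute value `|φ|` of a normal functional `φ`: the positive part of its polar
decomposition `φ = u |φ|`. Every normal functional has exactly one polar decomposition;
a functional without one gets the value `0`. -/
noncomputable def absFunctional (φ : M.toStarSubalgebra →ₗ[ℂ] ℂ) : M.toStarSubalgebra →ₗ[ℂ] ℂ :=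
  if h : ∃ ψ : M.toStarSubalgebra →ₗ[ℂ] ℂ, ∃ u : M.toStarSubalgebra, IsPolarDecomposition φ u ψ
  then h.choose else 0

end VonNeumannAlgebra

namespace VonNeumannAlgebra
open Filter Topology InnerProductSpace

variable {H : Type*} [NormedAddCommGroup H] [InnerProductSpace ℂ H] [CompleteSpace H]
  {M : VonNeumannAlgebra H}

/-! If `a` is central, its square root `b` commutes with the partial isometry `u` of `φ`, so φ(a) =
|φ|(b u b). Cauchy–Schwarz for |φ| bounds this by |φ|(a), because u*u ≤ 1
(`norm_map_le_of_mem_center`).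

Conversely, let h ∈ M be self-adjoint and ω_ξ a vector functional. The functional ω_ξ(e^{ith} ·) has
absolute value ω_ξ, so the hypothesis makes Re⟨e^{ith} a ξ, ξ⟩ maximal at t = 0. The vanishing
derivative says that ⟨h a ξ, ξ⟩ is real for every ξ; hence ha is self-adjoint and h commutes with a
(`commute_of_re_inner_exp_le`).

Most of the work makes `absFunctional`, defined by choice, usable, through
`exists_isPolarDecomposition` and `abs_unique`. For existence, weak compactness lets φ attain its
norm at a contraction x; then φ(x ·) is |φ|, and u is x* cut down by the support projection.
Uniqueness is the equality case of Cauchy–Schwarz. -/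

/-! ### Weak limits, the bicommutant and square roots -/

/-- Bounded nets of operators converge weakly along ultrafilters. -/
theorem exists_tendsto_inner {ι : Type*} (U : Ultrafilter ι) (T : ι → H →L[ℂ] H) {C : ℝ}
    (hC : 0 ≤ C) (hT : ∀ i, ‖T i‖ ≤ C) :
    ∃ S : H →L[ℂ] H, ‖S‖ ≤ C ∧
      ∀ ξ η : H, Tendsto (fun i => inner ℂ η (T i ξ)) U (𝓝 (inner ℂ η (S ξ))) := by
  have hb : ∀ ξ η : H, ∀ i, ‖inner ℂ (T i ξ) η‖ ≤ C * ‖ξ‖ * ‖η‖ := fun ξ η i =>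
    (norm_inner_le_norm _ _).trans <| by
      gcongr
      exact (T i).le_of_opNorm_le (hT i) ξ
  have hlim : ∀ ξ η : H, ∃ c : ℂ, ‖c‖ ≤ C * ‖ξ‖ * ‖η‖ ∧
      Tendsto (fun i => inner ℂ (T i ξ) η) U (𝓝 c) := by
    intro ξ η
    have := (isCompact_closedBall (0 : ℂ) (C * ‖ξ‖ * ‖η‖)).ultrafilter_le_nhds
      (U.map fun i => inner ℂ (T i ξ) η) (by
        rw [le_principal_iff]
        exact eventually_map.2 (Eventually.of_forall fun i => by simpa using hb ξ η i))
    obtain ⟨c, hc, h⟩ := this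
    exact ⟨c, by simpa using hc, h⟩
  choose B hB hBlim using hlim
  -- `T i ξ` sits in the conjugate-linear slot, giving the sesquilinear form that
  -- `continuousLinearMapOfBilin` expects.
  let B₀ : H →ₗ⋆[ℂ] H →ₗ[ℂ] ℂ := LinearMap.mk₂'ₛₗ (starRingEnd ℂ) (RingHom.id ℂ) B
    (fun ξ₁ ξ₂ η => tendsto_nhds_unique (hBlim _ _) <| by
      simpa [inner_add_left] using (hBlim ξ₁ η).add (hBlim ξ₂ η))
    (fun c ξ η => tendsto_nhds_unique (hBlim _ _) <| by
      simpa [inner_smul_left, mul_comm] using (hBlim ξ η).const_mul (starRingEnd ℂ c))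
    (fun ξ η₁ η₂ => tendsto_nhds_unique (hBlim _ _) <| by
      simpa [inner_add_right] using (hBlim ξ η₁).add (hBlim ξ η₂))
    (fun c ξ η => tendsto_nhds_unique (hBlim _ _) <| by
      simpa [inner_smul_right] using (hBlim ξ η).const_mul c)
  let B₁ : H →L⋆[ℂ] H →L[ℂ] ℂ := B₀.mkContinuous₂ C fun ξ η => hB ξ η
  have happ : ∀ ξ η, inner ℂ (continuousLinearMapOfBilin B₁ ξ) η = B ξ η := fun ξ η => by
    rw [continuousLinearMapOfBilin_apply]; rfl
  refine ⟨continuousLinearMapOfBilin B₁, ?_, fun ξ η => ?_⟩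
  · refine ContinuousLinearMap.opNorm_le_bound _ hC fun ξ => ?_
    set ζ := continuousLinearMapOfBilin B₁ ξ with hζ
    have h1 : ‖ζ‖ * ‖ζ‖ ≤ C * ‖ξ‖ * ‖ζ‖ := by
      have := hB ξ ζ
      rwa [← happ, ← hζ, inner_self_eq_norm_sq_to_K, norm_pow, RCLike.norm_ofReal, abs_norm,
        sq] at this
    rcases (norm_nonneg ζ).eq_or_lt with h | h
    · rw [← h]; positivity
    · exact le_of_mul_le_mul_right h1 h
  · have := (hBlim ξ η).star
    rw [← happ] at this
    simpa only [Complex.star_def, inner_conj_symm] using this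

/-- A weak limit of elements of a von Neumann algebra belongs to the algebra. -/
theorem mem_of_tendsto_inner {ι : Type*} {l : Filter ι} [l.NeBot] {T : ι → H →L[ℂ] H}
    {S : H →L[ℂ] H} (hT : ∀ i, T i ∈ M)
    (h : ∀ ξ η : H, Tendsto (fun i => inner ℂ η (T i ξ)) l (𝓝 (inner ℂ η (S ξ)))) : S ∈ M := by
  rw [← commutant_commutant M, mem_commutant_iff]
  intro g hg
  ext ξ
  refine ext_inner_left ℂ fun η => ?_
  refine tendsto_nhds_unique (f := fun i => inner ℂ η ((g * T i) ξ)) (l := l) ?_ ?_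
  · simpa [ContinuousLinearMap.adjoint_inner_left] using
      h ξ (ContinuousLinearMap.adjoint g η)
  · have : ∀ i, g * T i = T i * g := fun i => (mem_commutant_iff.1 hg _ (hT i)).symm
    simpa [this] using h (g ξ) η

/-- Keeps functional calculus inside M: `CFC.sqrt` and `NormedSpace.exp` commute with whatever
commutes with their (here self-adjoint, resp. arbitrary) argument. -/
theorem mem_of_forall_commute {S : H →L[ℂ] H}
    (h : ∀ g : H →L[ℂ] H, (∀ y ∈ M, Commute y g) → Commute g S) : S ∈ M := by
  rw [← commutant_commutant M, mem_commutant_iff]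
  exact fun g hg => h g fun y hy => mem_commutant_iff.1 hg y hy

theorem exists_sqrt {a : M.toStarSubalgebra} (ha : (a : H →L[ℂ] H).IsPositive) :
    ∃ b : M.toStarSubalgebra, star b = b ∧ b * b = a ∧ ∀ y, Commute a y → Commute b y := by
  have ha' : (0 : H →L[ℂ] H) ≤ a := (ContinuousLinearMap.nonneg_iff_isPositive _).2 ha
  have hc : ∀ g : H →L[ℂ] H, Commute (a : H →L[ℂ] H) g → Commute (CFC.sqrt (a : H →L[ℂ] H)) g :=
    fun g hg => hg.cfcₙ_nnreal _
  refine ⟨⟨CFC.sqrt (a : H →L[ℂ] H), mem_of_forall_commute fun g hg => (hc g (hg a a.2)).symm⟩,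
    ?_, ?_, fun y hy => ?_⟩
  · exact Subtype.ext (IsSelfAdjoint.of_nonneg (CFC.sqrt_nonneg _)).star_eq
  · exact Subtype.ext (CFC.sqrt_mul_sqrt_self _ ha')
  · exact Subtype.ext (hc y (congrArg Subtype.val hy))

theorem norm_apply_sq_eq_re (x : H →L[ℂ] H) (ξ : H) :
    ‖x ξ‖ ^ 2 = (inner ℂ ((star x * x) ξ) ξ).re := by
  have := ContinuousLinearMap.apply_norm_sq_eq_inner_adjoint_left x ξ
  simpa [ContinuousLinearMap.star_eq_adjoint] using this

theorem isPositive_one_sub_star_mul_self {x : H →L[ℂ] H} (hx : ‖x‖ ≤ 1) :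
    (1 - star x * x).IsPositive := by
  rw [ContinuousLinearMap.isPositive_def']
  refine ⟨(IsSelfAdjoint.one _).sub (IsSelfAdjoint.star_mul_self x), fun ξ => ?_⟩
  rw [ContinuousLinearMap.reApplyInnerSelf_apply, sub_apply, inner_sub_left,
    map_sub]
  have h1 := norm_apply_sq_eq_re x ξ
  have h2 : ‖x ξ‖ ≤ ‖ξ‖ := by simpa using x.le_of_opNorm_le hx ξ
  have h3 : ‖x ξ‖ ^ 2 ≤ ‖ξ‖ ^ 2 := by gcongr
  have h4 : RCLike.re (inner ℂ ((1 : H →L[ℂ] H) ξ) ξ) = ‖ξ‖ ^ 2 := by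
    simp [inner_self_eq_norm_sq_to_K, ← Complex.ofReal_pow]
  rw [h4]
  simp only [RCLike.re_to_complex]
  linarith

/-! ### Positive functionals and Cauchy–Schwarz -/

section Positive

variable {ψ : M.toStarSubalgebra →ₗ[ℂ] ℂ}

theorem IsPositiveFunctional.map_nonneg (hψ : IsPositiveFunctional ψ) {a : M.toStarSubalgebra}
    (ha : (a : H →L[ℂ] H).IsPositive) : 0 ≤ ψ a := by
  obtain ⟨b, hb, hba, -⟩ := exists_sqrt ha
  have := hψ b
  rwa [hb, hba] at this

/-- Polarization: reality of ψ(z*z) at z = x + y gives the imaginary part, at z = x + iy the real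
part. -/
theorem IsPositiveFunctional.conj_map_star_mul (hψ : IsPositiveFunctional ψ)
    (x y : M.toStarSubalgebra) : (starRingEnd ℂ) (ψ (star y * x)) = ψ (star x * y) := by
  have hx := (Complex.nonneg_iff.1 (hψ x)).2
  have hy := (Complex.nonneg_iff.1 (hψ y)).2
  have h1 := (Complex.nonneg_iff.1 (hψ (x + y))).2
  have h2 := (Complex.nonneg_iff.1 (hψ (x + Complex.I • y))).2
  simp only [star_add, star_smul, add_mul, mul_add, map_add, map_smul, smul_mul_assoc,
    mul_smul_comm, Complex.add_im, smul_eq_mul, Complex.mul_im, Complex.star_def,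
    Complex.conj_I, Complex.neg_im, Complex.neg_re, Complex.I_re, Complex.I_im,
    Complex.mul_re] at h1 h2
  apply Complex.ext <;> simp only [Complex.conj_re, Complex.conj_im] <;> linarith

theorem IsPositiveFunctional.norm_map_star_mul_sq_le (hψ : IsPositiveFunctional ψ)
    (x y : M.toStarSubalgebra) :
    ‖ψ (star x * y)‖ ^ 2 ≤ (ψ (star x * x)).re * (ψ (star y * y)).re := by
  let c : PreInnerProductSpace.Core ℂ M.toStarSubalgebra :=
    { inner := fun x y => ψ (star x * y)
      conj_inner_symm := fun x y => hψ.conj_map_star_mul x y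
      re_inner_nonneg := fun x => (Complex.nonneg_iff.1 (hψ x)).1
      add_left := fun x y z => by simp [add_mul]
      smul_left := fun x y r => by simp }
  have h := @InnerProductSpace.Core.inner_mul_inner_self_le ℂ M.toStarSubalgebra _ _ _ c x y
  have h2 : ‖ψ (star y * x)‖ = ‖ψ (star x * y)‖ := by
    rw [← hψ.conj_map_star_mul x y, RCLike.norm_conj]
  rw [sq]
  nth_rewrite 2 [← h2]
  exact h

theorem IsPositiveFunctional.map_star_mul_eq_zero (hψ : IsPositiveFunctional ψ)
    {x : M.toStarSubalgebra} (hx : ψ (star x * x) = 0) (y : M.toStarSubalgebra) :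
    ψ (star y * x) = 0 := by
  have := hψ.norm_map_star_mul_sq_le y x
  rw [hx, Complex.zero_re, mul_zero] at this
  exact norm_eq_zero.1 (pow_eq_zero_iff two_ne_zero |>.1 (le_antisymm this (sq_nonneg _)))

theorem IsPositiveFunctional.map_mul_eq_zero (hψ : IsPositiveFunctional ψ)
    {x : M.toStarSubalgebra} (hx : ψ (star x * x) = 0) (y : M.toStarSubalgebra) :
    ψ (y * x) = 0 := by
  simpa using hψ.map_star_mul_eq_zero hx (star y)

theorem IsPositiveFunctional.map_star_mul_eq_zero' (hψ : IsPositiveFunctional ψ)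
    {x : M.toStarSubalgebra} (hx : ψ (star x * x) = 0) (y : M.toStarSubalgebra) :
    ψ (star x * y) = 0 := by
  rw [← hψ.conj_map_star_mul, hψ.map_star_mul_eq_zero hx, map_zero]

/-- A positive element annihilated by a positive functional is in its left kernel. -/
theorem IsPositiveFunctional.map_star_mul_self_eq_zero_of_map_eq_zero
    (hψ : IsPositiveFunctional ψ) {h : M.toStarSubalgebra} (hh : (h : H →L[ℂ] H).IsPositive)
    (h0 : ψ h = 0) : ψ (star h * h) = 0 := by
  obtain ⟨b, hb, rfl, -⟩ := exists_sqrt hh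
  have := hψ.map_mul_eq_zero (x := b) (by rw [hb, h0]) (b * b * b)
  rw [star_mul, hb]
  simpa [mul_assoc] using this

end Positive

/-! ### Amplification, left kernels and support projections -/

/-- The diagonal action of an operator on the `ℓ²`-sum of countably many copies of `H`. -/
noncomputable def amplification (T : H →L[ℂ] H) :
    lp (fun _ : ℕ => H) 2 →L[ℂ] lp (fun _ : ℕ => H) 2 :=
  lp.mapCLM 2 (fun _ => T) (norm_nonneg T) fun _ => le_rfl

omit [CompleteSpace H] in
@[simp]
theorem amplification_apply (T : H →L[ℂ] H) (v : lp (fun _ : ℕ => H) 2) (n : ℕ) :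
    amplification T v n = T (v n) := rfl

theorem inner_amplification_left (T : H →L[ℂ] H) (v w : lp (fun _ : ℕ => H) 2) :
    inner ℂ (amplification T v) w = inner ℂ v (amplification (star T) w) := by
  simp only [lp.inner_eq_tsum, amplification_apply, ContinuousLinearMap.star_eq_adjoint,
    ContinuousLinearMap.adjoint_inner_right]

/-- The orbit map `x ↦ (x ⊗ 1) v` of a vector of the amplification. -/
noncomputable def orbitMap (M : VonNeumannAlgebra H) (v : lp (fun _ : ℕ => H) 2) :
    M.toStarSubalgebra →ₗ[ℂ] lp (fun _ : ℕ => H) 2 where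
  toFun x := amplification (x : H →L[ℂ] H) v
  map_add' x y := by ext n; simp
  map_smul' c x := by ext n; simp

omit [InnerProductSpace ℂ H] [CompleteSpace H] in
theorem memℓp_two_of_summable {ξ : ℕ → H} (h : Summable fun n => ‖ξ n‖ ^ 2) :
    Memℓp ξ 2 := by
  refine memℓp_gen ?_
  simpa using h

/-- A normal functional is a vector functional of the amplification. -/
theorem IsNormalFunctional.exists_eq_inner {φ : M.toStarSubalgebra →ₗ[ℂ] ℂ}
    (hφ : IsNormalFunctional φ) : ∃ ξ η : lp (fun _ : ℕ => H) 2, ∀ x : M.toStarSubalgebra,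
      φ x = inner ℂ η (amplification (x : H →L[ℂ] H) ξ) := by
  obtain ⟨ξ, η, hξ, hη, h⟩ := hφ
  refine ⟨⟨ξ, memℓp_two_of_summable hξ⟩, ⟨η, memℓp_two_of_summable hη⟩, fun x => ?_⟩
  exact (h x).unique (lp.hasSum_inner _ _)

/-- If `e` vanishes on the common kernel of a left ideal `J`, then `e` belongs to the closure
of `J` on every vector of the amplification. -/
theorem amplification_mem_closure_of_leftIdeal {J : Submodule ℂ M.toStarSubalgebra}
    (hJ : ∀ y, ∀ x ∈ J, y * x ∈ J) {e : M.toStarSubalgebra}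
    (he : ∀ w : H, (∀ x ∈ J, (x : H →L[ℂ] H) w = 0) → (e : H →L[ℂ] H) w = 0)
    (v : lp (fun _ : ℕ => H) 2) :
    amplification (e : H →L[ℂ] H) v ∈ (J.map (orbitMap M v)).topologicalClosure := by
  set V := (J.map (orbitMap M v)).topologicalClosure with hV
  have hVc : IsClosed (V : Set (lp (fun _ : ℕ => H) 2)) := Submodule.isClosed_topologicalClosure _
  have : CompleteSpace V := hVc.completeSpace_coe
  have hinv : ∀ y : M.toStarSubalgebra, ∀ u ∈ V, amplification (y : H →L[ℂ] H) u ∈ V := by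
    intro y u hu
    refine (map_mem_closure (amplification (y : H →L[ℂ] H)).continuous hu ?_ :
      amplification (y : H →L[ℂ] H) u ∈ closure (J.map (orbitMap M v) : Set _))
    rintro _ ⟨x, hx, rfl⟩
    exact ⟨y * x, hJ y x hx, rfl⟩
  have hinv' : ∀ y : M.toStarSubalgebra, ∀ u ∈ Vᗮ, amplification (y : H →L[ℂ] H) u ∈ Vᗮ := by
    intro y u hu z hz
    have := hu _ (hinv (star y) z hz)
    rwa [inner_amplification_left, StarMemClass.coe_star, star_star] at this
  obtain ⟨v₁, hv₁, v₂, hv₂, hsum⟩ := V.exists_add_mem_mem_orthogonal v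
  -- x v₂ = x v − x v₁ lies in V, and also in Vᗮ by invariance.
  have hzero : ∀ x ∈ J, amplification (x : H →L[ℂ] H) v₂ = 0 := by
    intro x hx
    have h1 : amplification (x : H →L[ℂ] H) v ∈ V :=
      Submodule.le_topologicalClosure _ ⟨x, hx, rfl⟩
    have h2 : amplification (x : H →L[ℂ] H) v₂ ∈ V := by
      have : amplification (x : H →L[ℂ] H) v₂ =
          amplification (x : H →L[ℂ] H) v - amplification (x : H →L[ℂ] H) v₁ := by
        rw [hsum, map_add, add_sub_cancel_left]
      rw [this]
      exact V.sub_mem h1 (hinv x _ hv₁)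
    exact inner_self_eq_zero.1 (hinv' x _ hv₂ _ h2)
  have he₂ : amplification (e : H →L[ℂ] H) v₂ = 0 := by
    ext n
    refine he _ fun x hx => ?_
    rw [← amplification_apply, hzero x hx]
    rfl
  rw [hsum, map_add, he₂, add_zero]
  exact hinv e _ hv₁

/-- The left kernel `{x | ψ(y x) = 0 for all y}` of a functional. -/
def leftKernel (ψ : M.toStarSubalgebra →ₗ[ℂ] ℂ) : Submodule ℂ M.toStarSubalgebra where
  carrier := {x | ∀ y, ψ (y * x) = 0}
  add_mem' {a b} ha hb y := by rw [mul_add, map_add, ha, hb, add_zero]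
  zero_mem' y := by simp
  smul_mem' c x hx y := by rw [mul_smul_comm, map_smul, hx, smul_zero]

theorem mul_mem_leftKernel {ψ : M.toStarSubalgebra →ₗ[ℂ] ℂ} {x : M.toStarSubalgebra}
    (hx : x ∈ leftKernel ψ) (y : M.toStarSubalgebra) : y * x ∈ leftKernel ψ := fun z => by
  rw [← mul_assoc]
  exact hx _

/-- The left kernel of a normal functional is generated by a projection. -/
theorem exists_isStarProjection_leftKernel {ψ : M.toStarSubalgebra →ₗ[ℂ] ℂ}
    (hψ : IsNormalFunctional ψ) : ∃ p : M.toStarSubalgebra, IsStarProjection p ∧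
      1 - p ∈ leftKernel ψ ∧ ∀ x ∈ leftKernel ψ, x * p = 0 := by
  let L : Submodule ℂ H := ⨅ x : leftKernel ψ, LinearMap.ker (x.1 : H →L[ℂ] H).toLinearMap
  have hL : ∀ w, w ∈ L ↔ ∀ x ∈ leftKernel ψ, (x : H →L[ℂ] H) w = 0 := fun w => by
    simp [L, Submodule.mem_iInf]
  have hLc : IsClosed (L : Set H) := by
    simp only [L, Submodule.coe_iInf]
    exact isClosed_iInter fun x => (x.1 : H →L[ℂ] H).isClosed_ker
  have : CompleteSpace L := hLc.completeSpace_coe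
  have hp : IsStarProjection L.starProjection := isStarProjection_starProjection
  have hpM : L.starProjection ∈ M := by
    rw [IsStarProjection.mem_iff hp]
    intro y hy w hw
    have hr : L.starProjection.range = L := Submodule.range_starProjection L
    rw [hr] at hw ⊢
    rw [hL] at hw
    refine (hL _).2 fun x hx => ?_
    have := congrArg (fun T : H →L[ℂ] H => T w) (mem_commutant_iff.1 hy x x.2)
    simpa [hw x hx] using this
  obtain ⟨ξ, η, h⟩ := hψ.exists_eq_inner
  let p : M.toStarSubalgebra := ⟨L.starProjection, hpM⟩
  refine ⟨p, ⟨Subtype.ext hp.isIdempotentElem, Subtype.ext hp.isSelfAdjoint⟩, fun y => ?_,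
    fun x hx => ?_⟩
  -- Normality enters here: (1 − p)ξ is a limit of vectors xξ with x in the left kernel, and φ is
  -- continuous in the orbit vector.
  · have hmem := amplification_mem_closure_of_leftIdeal (J := leftKernel ψ) (e := 1 - p)
      (fun y x hx => mul_mem_leftKernel hx y) (fun w hw => by
        have : L.starProjection w = w := Submodule.starProjection_eq_self_iff.2 ((hL w).2 hw)
        simp [p, this]) ξ
    rw [h]
    change inner ℂ η (amplification (y : H →L[ℂ] H)
      (amplification ((1 - p : M.toStarSubalgebra) : H →L[ℂ] H) ξ)) = 0
    refine closure_minimal (t := {u | inner ℂ η (amplification (y : H →L[ℂ] H) u) = 0}) ?_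
      (isClosed_eq (by fun_prop) continuous_const) hmem
    rintro _ ⟨x, hx, rfl⟩
    have := hx y
    rw [h] at this
    exact this
  · ext w
    exact (hL _).1 (Submodule.starProjection_apply_mem L w) x hx

/-- By Cauchy–Schwarz, ψ(1 − q) = 0 already puts 1 − q in the left kernel, so the projection
generating that kernel gives the support. -/
theorem IsPositiveFunctional.exists_isSupportProjection {ψ : M.toStarSubalgebra →ₗ[ℂ] ℂ}
    (hψ : IsPositiveFunctional ψ) (hn : IsNormalFunctional ψ) :
    ∃ p : M.toStarSubalgebra, IsSupportProjection ψ p ∧ 1 - p ∈ leftKernel ψ ∧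
      ∀ x ∈ leftKernel ψ, x * p = 0 := by
  obtain ⟨p, hp, h1, h2⟩ := exists_isStarProjection_leftKernel hn
  refine ⟨p, ⟨hp, by simpa using h1 1, fun q hq h0 => ?_⟩, h1, h2⟩
  have hq' : IsStarProjection (1 - q) := hq.one_sub
  have h3 : (1 - q) * p = 0 := h2 _ fun y => hψ.map_mul_eq_zero
    (by rw [hq'.isSelfAdjoint.star_eq, hq'.isIdempotentElem.eq, h0]) y
  have h4 : q * p = p := by rw [sub_mul, one_mul, sub_eq_zero] at h3; exact h3.symm
  have := congrArg star h4
  rwa [star_mul, hp.isSelfAdjoint.star_eq, hq.isSelfAdjoint.star_eq] at this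

/-! ### Normal functionals attain their norm -/

section Normal

variable {φ : M.toStarSubalgebra →ₗ[ℂ] ℂ}

theorem IsNormalFunctional.exists_norm_le (hφ : IsNormalFunctional φ) :
    ∃ C : ℝ, ∀ x : M.toStarSubalgebra, ‖φ x‖ ≤ C * ‖(x : H →L[ℂ] H)‖ := by
  obtain ⟨ξ, η, h⟩ := hφ.exists_eq_inner
  refine ⟨‖η‖ * ‖ξ‖, fun x => ?_⟩
  rw [h]
  calc _ ≤ ‖η‖ * ‖amplification (x : H →L[ℂ] H) ξ‖ := norm_inner_le_norm _ _
    _ ≤ ‖η‖ * (‖(x : H →L[ℂ] H)‖ * ‖ξ‖) := by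
        gcongr
        exact ContinuousLinearMap.le_of_opNorm_le _ (lp.norm_mapCLM_le _ _ _ _) _
    _ = _ := by ring

/-- Normal functionals are weakly continuous along bounded families. -/
theorem IsNormalFunctional.tendsto_of_tendsto_inner (hφ : IsNormalFunctional φ) {ι : Type*}
    {l : Filter ι} {x : ι → M.toStarSubalgebra} {y : M.toStarSubalgebra} {C : ℝ}
    (hx : ∀ i, ‖(x i : H →L[ℂ] H)‖ ≤ C)
    (h : ∀ ξ η : H, Tendsto (fun i => inner ℂ η ((x i : H →L[ℂ] H) ξ)) l
      (𝓝 (inner ℂ η ((y : H →L[ℂ] H) ξ)))) :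
    Tendsto (fun i => φ (x i)) l (𝓝 (φ y)) := by
  obtain ⟨ξ, η, hξ, hη, hsum⟩ := hφ
  simp only [← (hsum _).tsum_eq]
  refine tendsto_tsum_of_dominated_convergence
    (bound := fun n => C * (‖ξ n‖ ^ 2 + ‖η n‖ ^ 2)) ((hξ.add hη).mul_left C)
    (fun n => h _ _) (Eventually.of_forall fun i n => ?_)
  have hC : 0 ≤ C := (norm_nonneg _).trans (hx i)
  calc _ ≤ ‖η n‖ * ‖(x i : H →L[ℂ] H) (ξ n)‖ := norm_inner_le_norm _ _
    _ ≤ ‖η n‖ * (C * ‖ξ n‖) := by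
        gcongr
        exact ContinuousLinearMap.le_of_opNorm_le _ (hx i) _
    _ = C * (‖ξ n‖ * ‖η n‖) := by ring
    _ ≤ _ := by
        gcongr
        nlinarith [sq_nonneg (‖ξ n‖ - ‖η n‖), sq_nonneg (‖ξ n‖), sq_nonneg (‖η n‖)]

/-- A normal functional attains its norm on the unit ball. -/
theorem IsNormalFunctional.exists_norm_attained (hφ : IsNormalFunctional φ) :
    ∃ (x : M.toStarSubalgebra) (S : ℝ), ‖(x : H →L[ℂ] H)‖ ≤ 1 ∧ φ x = S ∧ 0 ≤ S ∧
      ∀ y : M.toStarSubalgebra, ‖φ y‖ ≤ S * ‖(y : H →L[ℂ] H)‖ := by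
  obtain ⟨C, hC⟩ := hφ.exists_norm_le
  let A : Set ℝ := {r | ∃ x : M.toStarSubalgebra, ‖(x : H →L[ℂ] H)‖ ≤ 1 ∧ ‖φ x‖ = r}
  have hA0 : (0 : ℝ) ∈ A := ⟨0, by simp, by simp⟩
  have hAb : BddAbove A := by
    refine ⟨|C|, ?_⟩
    rintro _ ⟨x, hx, rfl⟩
    calc _ ≤ C * ‖(x : H →L[ℂ] H)‖ := hC x
      _ ≤ |C| * 1 := by gcongr; exact le_abs_self C
      _ = _ := mul_one _
  obtain ⟨r, -, hr, hrA⟩ := exists_seq_tendsto_sSup ⟨0, hA0⟩ hAb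
  choose x hx hxr using hrA
  obtain ⟨T, hT, hlim⟩ := exists_tendsto_inner (hyperfilter ℕ) (fun n => (x n : H →L[ℂ] H))
    zero_le_one hx
  let x₀ : M.toStarSubalgebra := ⟨T, mem_of_tendsto_inner (fun n => (x n).2) hlim⟩
  have h1 : Tendsto (fun n => φ (x n)) (hyperfilter ℕ) (𝓝 (φ x₀)) :=
    hφ.tendsto_of_tendsto_inner hx hlim
  have h2 : ‖φ x₀‖ = sSup A := by
    refine tendsto_nhds_unique h1.norm ?_
    simp only [hxr]
    exact hr.mono_left Nat.hyperfilter_le_atTop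
  have h3 : ∀ y : M.toStarSubalgebra, ‖φ y‖ ≤ ‖φ x₀‖ * ‖(y : H →L[ℂ] H)‖ := by
    intro y
    rcases (norm_nonneg (y : H →L[ℂ] H)).eq_or_lt with h | h
    · have := hC y
      rw [← h, mul_zero] at this ⊢
      exact this
    · have h4 : ‖φ ((‖(y : H →L[ℂ] H)‖⁻¹ : ℂ) • y)‖ ≤ sSup A := by
        refine le_csSup hAb ⟨_, ?_, rfl⟩
        rw [SetLike.val_smul, norm_smul]
        simp [h.ne']
      rw [map_smul, norm_smul, ← h2] at h4
      simp only [norm_inv, Complex.norm_real, norm_norm] at h4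
      rwa [inv_mul_le_iff₀ h, mul_comm] at h4
  obtain ⟨c, hc, hcφ⟩ : ∃ c : ℂ, ‖c‖ ≤ 1 ∧ c * φ x₀ = ‖φ x₀‖ := by
    obtain ⟨c, hc, h⟩ := RCLike.exists_norm_eq_mul_self (φ x₀)
    exact ⟨c, hc.le, h.symm⟩
  refine ⟨c • x₀, ‖φ x₀‖, ?_, ?_, norm_nonneg _, h3⟩
  · rw [SetLike.val_smul, norm_smul]
    exact mul_le_one₀ hc (norm_nonneg _) hT
  · rw [map_smul, smul_eq_mul, hcφ]

theorem IsNormalFunctional.mulLeft (hφ : IsNormalFunctional φ) (x : M.toStarSubalgebra) :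
    IsNormalFunctional (φ ∘ₗ LinearMap.mulLeft ℂ x) := by
  obtain ⟨ξ, η, hξ, hη, hsum⟩ := hφ
  refine ⟨ξ, fun n => ContinuousLinearMap.adjoint (x : H →L[ℂ] H) (η n), hξ,
    Summable.of_nonneg_of_le (fun n => sq_nonneg _) (fun n => ?_)
      (hη.mul_left (‖(x : H →L[ℂ] H)‖ ^ 2)), fun y => ?_⟩
  · rw [← mul_pow]
    gcongr
    exact ContinuousLinearMap.le_of_opNorm_le _ (by simp) _
  · simpa [ContinuousLinearMap.adjoint_inner_left] using hsum (x * y)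

end Normal

/-! ### Existence of the polar decomposition -/

section NormAttained

variable {φ ψ : M.toStarSubalgebra →ₗ[ℂ] ℂ}

theorem norm_sq_add_norm_sq_le {x : H →L[ℂ] H} (hx : ‖x‖ ≤ 1) (ζ : H) :
    ‖x ζ‖ ^ 2 + ‖(1 - star x * x) ζ‖ ^ 2 ≤ ‖ζ‖ ^ 2 := by
  have h1 : ‖ζ - (star x * x) ζ‖ ^ 2 = ‖ζ‖ ^ 2 - 2 * ‖x ζ‖ ^ 2 + ‖(star x * x) ζ‖ ^ 2 := by
    rw [@norm_sub_sq ℂ, norm_apply_sq_eq_re x ζ, ← inner_conj_symm]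
    rfl
  have h2 : ‖(star x * x) ζ‖ ≤ ‖x ζ‖ := by
    simpa using (star x).le_of_opNorm_le ((norm_star x).trans_le hx) (x ζ)
  have h3 : ‖(star x * x) ζ‖ ^ 2 ≤ ‖x ζ‖ ^ 2 := by gcongr
  have h4 : (1 - star x * x) ζ = ζ - (star x * x) ζ := rfl
  rw [h4, h1]
  linarith

/-- Cauchy–Schwarz in ℝ² for (1, ‖y‖) and (‖xζ‖, ‖(1 − x*x)ζ‖). Such a perturbation of x raises the
norm bound only to second order in y. -/
theorem norm_add_mul_one_sub_sq_le {x : H →L[ℂ] H} (hx : ‖x‖ ≤ 1) (y : H →L[ℂ] H) :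
    ‖x + y * (1 - star x * x)‖ ^ 2 ≤ 1 + ‖y‖ ^ 2 := by
  have h : ‖x + y * (1 - star x * x)‖ ≤ √(1 + ‖y‖ ^ 2) := by
    refine ContinuousLinearMap.opNorm_le_bound _ (Real.sqrt_nonneg _) fun ζ => ?_
    have h1 := norm_sq_add_norm_sq_le hx ζ
    set A := ‖x ζ‖
    set B := ‖(1 - star x * x) ζ‖
    have h2 : ‖(x + y * (1 - star x * x)) ζ‖ ≤ A + ‖y‖ * B :=
      (norm_add_le _ _).trans (add_le_add_right (y.le_opNorm _) _)
    refine h2.trans (abs_le_of_sq_le_sq' ?_ (by positivity)).2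
    rw [mul_pow, Real.sq_sqrt (by positivity)]
    calc (A + ‖y‖ * B) ^ 2 ≤ (1 + ‖y‖ ^ 2) * (A ^ 2 + B ^ 2) := by
          nlinarith [sq_nonneg (B - ‖y‖ * A)]
      _ ≤ _ := by gcongr
  calc _ ≤ √(1 + ‖y‖ ^ 2) ^ 2 := by gcongr
    _ = _ := Real.sq_sqrt (by positivity)

theorem nonpos_of_forall_add_mul_sq_le {S δ Y : ℝ} (hS : 0 ≤ S)
    (h : ∀ t : ℝ, 0 ≤ t → (S + t * δ) ^ 2 ≤ S ^ 2 * (1 + t ^ 2 * Y ^ 2)) : δ ≤ 0 := by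
  by_contra! hδ
  rcases hS.eq_or_lt with rfl | hS0
  · have := h 1 zero_le_one
    nlinarith
  -- At this t the quadratic term is too small to absorb the linear gain 2Stδ; the summand 1 covers
  -- Y = 0.
  have h2 := h (δ / (S * (1 + Y ^ 2))) (by positivity)
  set t := δ / (S * (1 + Y ^ 2)) with ht
  have ht0 : 0 < t := by positivity
  have h3 : t * (S * (1 + Y ^ 2)) = δ := by rw [ht]; field_simp
  have h4 : 2 * S * δ ≤ S ^ 2 * t * Y ^ 2 := by
    have : t * (2 * S * δ) ≤ t * (S ^ 2 * t * Y ^ 2) := by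
      nlinarith [sq_nonneg (t * δ)]
    exact le_of_mul_le_mul_left this ht0
  have h5 : S ^ 2 * t * Y ^ 2 ≤ S * δ := by
    rw [← h3]
    nlinarith [mul_pos (mul_pos hS0 hS0) ht0]
  nlinarith [mul_pos hS0 hδ]

/-- If `φ` attains its norm at the contraction `x`, then `φ = φ(x x* ·)`. -/
theorem map_mul_star_mul_of_norm_attained {S : ℝ} (hS : 0 ≤ S)
    (hφ : ∀ y : M.toStarSubalgebra, ‖φ y‖ ≤ S * ‖(y : H →L[ℂ] H)‖) {x : M.toStarSubalgebra}
    (hx : ‖(x : H →L[ℂ] H)‖ ≤ 1) (hφx : φ x = S) (y : M.toStarSubalgebra) :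
    φ (x * star x * y) = φ y := by
  have key : φ ((1 - x * star x) * y) = 0 := by
    obtain ⟨c, hc, hcφ⟩ := RCLike.exists_norm_eq_mul_self (φ ((1 - x * star x) * y))
    set δ := ‖φ ((1 - x * star x) * y)‖ with hδ
    set Y := ‖(y : H →L[ℂ] H)‖
    have hbound : ∀ t : ℝ, 0 ≤ t → (S + t * δ) ^ 2 ≤ S ^ 2 * (1 + t ^ 2 * Y ^ 2) := by
      intro t ht
      let z : M.toStarSubalgebra := x + ((t : ℂ) * c) • ((1 - x * star x) * y)
      have hz : φ z = ((S + t * δ : ℝ) : ℂ) := by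
        simp only [z, map_add, map_smul, smul_eq_mul, hφx, mul_assoc]
        rw [← hcφ]
        push_cast
        rfl
      have hzn : ‖(z : H →L[ℂ] H)‖ ^ 2 ≤ 1 + t ^ 2 * Y ^ 2 := by
        -- The defect 1 − xx* multiplies from the left in z, so the bound is applied to z*.
        have := norm_add_mul_one_sub_sq_le (x := star (x : H →L[ℂ] H)) (by rwa [norm_star])
          (star (((t : ℂ) * c) • (y : H →L[ℂ] H)))
        rw [norm_star, norm_smul, norm_mul, hc, Complex.norm_real, Real.norm_eq_abs, mul_one,
          mul_pow, sq_abs] at this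
        have hz' : star (z : H →L[ℂ] H) = star (x : H →L[ℂ] H) +
            star (((t : ℂ) * c) • (y : H →L[ℂ] H)) *
              (1 - star (star (x : H →L[ℂ] H)) * star (x : H →L[ℂ] H)) := by
          have hz₀ : (z : H →L[ℂ] H) = x + ((t : ℂ) * c) • ((1 - x * star (x : H →L[ℂ] H)) * y) :=
            rfl
          rw [hz₀, star_add, star_smul, star_smul, star_mul, star_mul, star_sub, star_one, star_mul,
            smul_mul_assoc]
        rw [← norm_star, hz']
        exact this
      have h1 := hφ z
      rw [hz, Complex.norm_real, Real.norm_eq_abs,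
        abs_of_nonneg (add_nonneg hS (mul_nonneg ht (norm_nonneg _)))] at h1
      calc _ ≤ (S * ‖(z : H →L[ℂ] H)‖) ^ 2 :=
            pow_le_pow_left₀ (add_nonneg hS (mul_nonneg ht (norm_nonneg _))) h1 2
        _ = S ^ 2 * ‖(z : H →L[ℂ] H)‖ ^ 2 := mul_pow _ _ _
        _ ≤ _ := by gcongr
    rw [← norm_eq_zero, ← hδ]
    exact le_antisymm (nonpos_of_forall_add_mul_sq_le hS hbound) (norm_nonneg _)
  rw [sub_mul, one_mul, map_sub, sub_eq_zero] at key
  exact key.symm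

/-- Re ψ(1 + ith) moves linearly in t with slope −Im ψ(h), while ‖1 + ith‖² ≤ 1 + t²‖h‖². Both signs
of t are used. -/
theorem im_map_eq_zero_of_norm_le {S : ℝ} (hS : 0 ≤ S)
    (hψ : ∀ y : M.toStarSubalgebra, ‖ψ y‖ ≤ S * ‖(y : H →L[ℂ] H)‖) (h1 : ψ 1 = S)
    {h : M.toStarSubalgebra} (hh : star h = h) : (ψ h).im = 0 := by
  have hbound : ∀ t : ℝ, (S - t * (ψ h).im) ^ 2 ≤ S ^ 2 * (1 + t ^ 2 * ‖(h : H →L[ℂ] H)‖ ^ 2) := by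
    intro t
    let z : M.toStarSubalgebra := 1 + ((t : ℂ) * Complex.I) • h
    have hz : (ψ z).re = S - t * (ψ h).im := by
      simp [z, h1, sub_eq_add_neg]
    have hzn : ‖(z : H →L[ℂ] H)‖ ^ 2 ≤ 1 + t ^ 2 * ‖(h : H →L[ℂ] H)‖ ^ 2 := by
      have e : star (z : H →L[ℂ] H) * z = 1 + ((t : ℂ) ^ 2) • ((h : H →L[ℂ] H) * h) := by
        have hh' : star (h : H →L[ℂ] H) = h := congrArg Subtype.val hh
        have hc : star ((t : ℂ) * Complex.I) = -(t * Complex.I) := by simp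
        have hI : ((t : ℂ) * Complex.I) * (t * Complex.I) = -t ^ 2 := by
          linear_combination (t ^ 2 : ℂ) * Complex.I_sq
        have hz₀ : (z : H →L[ℂ] H) = 1 + ((t : ℂ) * Complex.I) • (h : H →L[ℂ] H) := rfl
        rw [hz₀, star_add, star_one, star_smul, hh', hc, neg_smul, ← sub_eq_add_neg, sub_mul,
          one_mul, mul_add, mul_one, smul_mul_smul_comm, hI, neg_smul]
        abel
      rw [sq, ← CStarRing.norm_star_mul_self, e]
      refine (norm_add_le _ _).trans (add_le_add ContinuousLinearMap.norm_id_le ?_)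
      rw [norm_smul, norm_pow, Complex.norm_real, Real.norm_eq_abs, sq_abs, sq ‖(h : H →L[ℂ] H)‖]
      gcongr
      exact norm_mul_le _ _
    calc (S - t * (ψ h).im) ^ 2 = |(ψ z).re| ^ 2 := by rw [hz, sq_abs]
      _ ≤ ‖ψ z‖ ^ 2 := by gcongr; exact Complex.abs_re_le_norm _
      _ ≤ (S * ‖(z : H →L[ℂ] H)‖) ^ 2 := by gcongr; exact hψ z
      _ = S ^ 2 * ‖(z : H →L[ℂ] H)‖ ^ 2 := mul_pow _ _ _
      _ ≤ _ := by gcongr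
  refine le_antisymm (nonpos_of_forall_add_mul_sq_le hS (Y := ‖(h : H →L[ℂ] H)‖) fun t _ => ?_)
    (neg_nonpos.1 (nonpos_of_forall_add_mul_sq_le hS (Y := ‖(h : H →L[ℂ] H)‖) fun t _ => ?_))
  · simpa using hbound (-t)
  · simpa [sub_eq_add_neg] using hbound t

/-- A functional whose norm is its value at `1` is positive. -/
theorem isPositiveFunctional_of_norm_le {S : ℝ} (hS : 0 ≤ S)
    (hψ : ∀ y : M.toStarSubalgebra, ‖ψ y‖ ≤ S * ‖(y : H →L[ℂ] H)‖) (h1 : ψ 1 = S) :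
    IsPositiveFunctional ψ := by
  have key : ∀ x : M.toStarSubalgebra, ‖(x : H →L[ℂ] H)‖ ≤ 1 → 0 ≤ (ψ (star x * x)).re := by
    intro x hx
    have h2 : ‖((1 - star x * x : M.toStarSubalgebra) : H →L[ℂ] H)‖ ≤ 1 := by
      refine ContinuousLinearMap.opNorm_le_bound _ zero_le_one fun ζ => ?_
      have h3 := norm_sq_add_norm_sq_le hx ζ
      rw [one_mul]
      refine (abs_le_of_sq_le_sq' ?_ (norm_nonneg _)).2
      exact (le_add_of_nonneg_left (sq_nonneg _)).trans h3
    have h4 : S - (ψ (star x * x)).re ≤ S := by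
      calc S - (ψ (star x * x)).re = (ψ (1 - star x * x)).re := by simp [h1]
        _ ≤ ‖ψ (1 - star x * x)‖ := Complex.re_le_norm _
        _ ≤ S * _ := hψ _
        _ ≤ S * 1 := by gcongr
        _ = S := mul_one S
    linarith
  intro x
  refine Complex.nonneg_iff.2 ⟨?_, (im_map_eq_zero_of_norm_le hS hψ h1 (by simp)).symm⟩
  rcases (norm_nonneg (x : H →L[ℂ] H)).eq_or_lt with h | h
  · have : x = 0 := Subtype.ext (norm_eq_zero.1 h.symm)
    simp [this]
  · have h2 := key (((‖(x : H →L[ℂ] H)‖⁻¹ : ℝ) : ℂ) • x) (by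
      rw [SetLike.val_smul, norm_smul]
      simp [h.ne'])
    rw [star_smul, smul_mul_smul_comm, Complex.star_def, Complex.conj_ofReal,
      ← Complex.ofReal_mul, map_smul, smul_eq_mul, Complex.re_ofReal_mul] at h2
    exact nonneg_of_mul_nonneg_right h2 (by positivity)

/-- Every normal functional has a polar decomposition. -/
theorem IsNormalFunctional.exists_isPolarDecomposition (hφ : IsNormalFunctional φ) :
    ∃ ψ : M.toStarSubalgebra →ₗ[ℂ] ℂ, ∃ u : M.toStarSubalgebra, IsPolarDecomposition φ u ψ := by
  obtain ⟨x, S, hx, hφx, hS, hbound⟩ := hφ.exists_norm_attained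
  have hmul := map_mul_star_mul_of_norm_attained hS hbound hx hφx
  set ψ := φ ∘ₗ LinearMap.mulLeft ℂ x with hψ
  have happ : ∀ y, ψ y = φ (x * y) := fun y => rfl
  have hn : IsNormalFunctional ψ := hφ.mulLeft x
  have hpos : IsPositiveFunctional ψ := by
    refine isPositiveFunctional_of_norm_le hS (fun y => (hbound (x * y)).trans ?_)
      (by rw [happ, mul_one, hφx])
    gcongr
    calc _ ≤ ‖(x : H →L[ℂ] H)‖ * ‖(y : H →L[ℂ] H)‖ := norm_mul_le _ _
      _ ≤ 1 * ‖(y : H →L[ℂ] H)‖ := by gcongr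
      _ = _ := one_mul _
  obtain ⟨p, hp, hp1, hp2⟩ := hpos.exists_isSupportProjection hn
  have hps : star p = p := hp.isStarProjection.isSelfAdjoint
  have hpp : p * p = p := hp.isStarProjection.isIdempotentElem
  -- 1 − x*x is positive and ψ(1 − x*x) = φ(x) − φ(xx*x) = 0, so it lies in the left kernel. Thus x*
  -- is isometric in the sense needed for u = px* to satisfy uu* = p.
  have hdef : (1 - star x * x) * p = 0 := by
    refine hp2 _ fun y => hpos.map_mul_eq_zero
      (hpos.map_star_mul_self_eq_zero_of_map_eq_zero (isPositive_one_sub_star_mul_self hx) ?_) y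
    rw [map_sub, sub_eq_zero, happ, happ, ← mul_assoc, hmul, mul_one]
  have hxp : star x * x * p = p := by rw [sub_mul, one_mul, sub_eq_zero] at hdef; exact hdef.symm
  have huu : p * star x * star (p * star x) = p := by
    rw [star_mul, star_star, hps, mul_assoc, ← mul_assoc (star x), hxp, hpp]
  refine ⟨ψ, p * star x, hn, hpos, ?_, fun y => ?_, by rwa [huu]⟩
  · rw [huu, ← mul_assoc, hpp]
  · have h0 : ψ (star (1 - p) * (star x * y)) = 0 :=
      hpos.map_star_mul_eq_zero' (hp1 _) _
    rw [star_sub, star_one, hps, sub_mul, one_mul, map_sub, sub_eq_zero] at h0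
    rw [mul_assoc, ← h0, happ, ← mul_assoc, hmul]

end NormAttained

/-! ### Uniqueness of the absolute value -/

section PolarDecomposition

variable {φ ψ ψ' : M.toStarSubalgebra →ₗ[ℂ] ℂ} {u u' : M.toStarSubalgebra}

theorem IsPositiveFunctional.map_projection_nonneg (hψ : IsPositiveFunctional ψ)
    {q : M.toStarSubalgebra} (hq : IsStarProjection q) (y : M.toStarSubalgebra) :
    0 ≤ ψ (star y * q * y) := by
  have := hψ (q * y)
  rwa [star_mul, hq.isSelfAdjoint.star_eq, mul_assoc, ← mul_assoc q,
    hq.isIdempotentElem.eq, ← mul_assoc] at this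

theorem IsSupportProjection.map_mul (hψ : IsPositiveFunctional ψ) {p : M.toStarSubalgebra}
    (hp : IsSupportProjection ψ p) (y : M.toStarSubalgebra) : ψ (p * y) = ψ y := by
  have hq := hp.isStarProjection.one_sub
  have h := hψ.map_star_mul_eq_zero' (x := 1 - p)
    (by rw [hq.isSelfAdjoint.star_eq, hq.isIdempotentElem.eq, hp.map_one_sub]) y
  rw [hq.isSelfAdjoint.star_eq, sub_mul, one_mul, map_sub, sub_eq_zero] at h
  exact h.symm

namespace IsPolarDecomposition

theorem isStarProjection_star_mul (h : IsPolarDecomposition φ u ψ) :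
    IsStarProjection (star u * u) :=
  ⟨by rw [IsIdempotentElem, mul_assoc, ← mul_assoc u, h.partialIsometry],
    IsSelfAdjoint.star_mul_self u⟩

theorem abs_eq_map (h : IsPolarDecomposition φ u ψ) (y : M.toStarSubalgebra) :
    ψ y = φ (star u * y) := by
  rw [h.eq_mul, ← mul_assoc, h.support.map_mul h.positive]

/-- |ψ'(u'u*)|² ≤ ψ'(u'u'*) ψ'(uu*) ≤ ψ'(1)², and the left side is ψ(1)². Exchanging the roles gives
equality. -/
theorem abs_one_re_le (h : IsPolarDecomposition φ u ψ) (h' : IsPolarDecomposition φ u' ψ') :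
    (ψ 1).re ≤ (ψ' 1).re := by
  have h1 : ψ 1 = ψ' (u' * star u) := by rw [h.abs_eq_map, mul_one, h'.eq_mul]
  have h2 := h'.positive.norm_map_star_mul_sq_le (star u') (star u)
  rw [star_star, star_star, ← h1] at h2
  have h3 : ψ' (u' * star u') = ψ' 1 := by
    simpa using h'.support.map_mul h'.positive 1
  have h4 : (ψ' (u * star u)).re ≤ (ψ' 1).re := by
    have := h'.positive.map_projection_nonneg h.support.isStarProjection.one_sub 1
    rw [star_one, one_mul, mul_one, map_sub] at this
    simpa using (Complex.nonneg_iff.1 this).1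
  have h5 : 0 ≤ (ψ' 1).re := by simpa using (Complex.nonneg_iff.1 (h'.positive 1)).1
  rw [h3] at h2
  refine (Complex.re_le_norm _).trans (abs_le_of_sq_le_sq' (h2.trans ?_) h5).2
  rw [sq]
  gcongr

/-- The positive part of a polar decomposition is unique. -/
theorem abs_unique (h : IsPolarDecomposition φ u ψ) (h' : IsPolarDecomposition φ u' ψ') :
    ψ = ψ' := by
  have h1 : ∀ y, ψ y = ψ' (u' * star u * y) := fun y => by
    rw [h.abs_eq_map, h'.eq_mul, mul_assoc]
  have him : ∀ {χ : M.toStarSubalgebra →ₗ[ℂ] ℂ}, IsPositiveFunctional χ → (χ 1).im = 0 :=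
    fun hχ => by simpa using (Complex.nonneg_iff.1 (hχ 1)).2.symm
  have h2 : ψ 1 = ψ' 1 := Complex.ext (le_antisymm (h.abs_one_re_le h') (h'.abs_one_re_le h))
    ((him h.positive).trans (him h'.positive).symm)
  set w := u' * star u with hw
  have h3 : ψ' w = ψ' 1 := by rw [← h2, h1, mul_one]
  have h4 : ψ' (star w) = ψ' 1 := by
    have := h'.positive.conj_map_star_mul w 1
    rw [star_one, one_mul, mul_one, h3] at this
    rw [← this, Complex.conj_eq_iff_im]
    exact him h'.positive
  have h5 : ψ' (w * star w) ≤ ψ' 1 := by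
    have := h'.positive.map_projection_nonneg h.isStarProjection_star_mul.one_sub (star u')
    rw [star_star, mul_sub, mul_one, sub_mul, map_sub, sub_nonneg] at this
    have e : ψ' (u' * star u') = ψ' 1 := by simpa using h'.support.map_mul h'.positive 1
    rw [e] at this
    rwa [hw, star_mul, star_star, mul_assoc, ← mul_assoc (star u), ← mul_assoc]
  -- Equality case: ψ'((1 − w)(1 − w*)) expands to ψ'(ww*) − ψ'(1) ≤ 0, so ψ' = ψ'(w ·) = ψ.
  have h6 : ψ' (star (1 - star w) * (1 - star w)) = 0 := by
    refine le_antisymm ?_ (h'.positive _)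
    rw [star_sub, star_one, star_star, sub_mul, one_mul, mul_sub, mul_one, map_sub, map_sub,
      map_sub, h3, h4, sub_self, zero_sub, neg_sub, sub_nonpos]
    exact h5
  ext y
  have h7 := h'.positive.map_star_mul_eq_zero' h6 y
  rw [star_sub, star_one, star_star, sub_mul, one_mul, map_sub, sub_eq_zero] at h7
  rw [h1, h7]

theorem absFunctional_eq (h : IsPolarDecomposition φ u ψ) : absFunctional φ = ψ := by
  have hex : ∃ ψ : M.toStarSubalgebra →ₗ[ℂ] ℂ, ∃ u : M.toStarSubalgebra,
    IsPolarDecomposition φ u ψ := ⟨ψ, u, h⟩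
  rw [absFunctional, dif_pos hex]
  obtain ⟨u', hu'⟩ := hex.choose_spec
  exact hu'.abs_unique h

end IsPolarDecomposition

/-- Supplies the test functionals of the converse. Cutting u by p makes the final projection exactly
the support. -/
theorem IsPositiveFunctional.isPolarDecomposition_mulLeft (hψ : IsPositiveFunctional ψ)
    {p : M.toStarSubalgebra} (hn : IsNormalFunctional ψ) (hp : IsSupportProjection ψ p)
    (hu : u * star u = 1) :
    IsPolarDecomposition (ψ ∘ₗ LinearMap.mulLeft ℂ u) (p * u) ψ := by
  have hps : star p = p := hp.isStarProjection.isSelfAdjoint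
  have hpp : p * p = p := hp.isStarProjection.isIdempotentElem
  have huu : p * u * star (p * u) = p := by
    rw [star_mul, hps, mul_assoc, ← mul_assoc u, hu, one_mul, hpp]
  refine ⟨hn, hψ, by rw [huu, ← mul_assoc, hpp], fun y => ?_, by rwa [huu]⟩
  rw [mul_assoc, hp.map_mul hψ]
  rfl

end PolarDecomposition

/-! ### Vector functionals and the exponential argument -/

section VectorFunctional

/-- The vector functional `x ↦ ⟨x ξ, ξ⟩`. -/
noncomputable def vectorFunctional (M : VonNeumannAlgebra H) (ξ : H) :
    M.toStarSubalgebra →ₗ[ℂ] ℂ where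
  toFun x := inner ℂ ξ ((x : H →L[ℂ] H) ξ)
  map_add' x y := by simp
  map_smul' c x := by simp

theorem vectorFunctional_apply (ξ : H) (x : M.toStarSubalgebra) :
    vectorFunctional M ξ x = inner ℂ ξ ((x : H →L[ℂ] H) ξ) := rfl

theorem isPositiveFunctional_vectorFunctional (ξ : H) :
    IsPositiveFunctional (vectorFunctional M ξ) := fun x => by
  have : vectorFunctional M ξ (star x * x) =
      inner ℂ ((x : H →L[ℂ] H) ξ) ((x : H →L[ℂ] H) ξ) := by
    simp [vectorFunctional_apply, ContinuousLinearMap.star_eq_adjoint,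
      ContinuousLinearMap.adjoint_inner_right]
  rw [this, inner_self_eq_norm_sq_to_K]
  exact pow_nonneg (Complex.zero_le_real.2 (norm_nonneg ((x : H →L[ℂ] H) ξ))) 2

theorem isNormalFunctional_vectorFunctional (ξ : H) :
    IsNormalFunctional (vectorFunctional M ξ) := by
  have hs : Summable fun n : ℕ => ‖(Pi.single 0 ξ : ℕ → H) n‖ ^ 2 :=
    summable_of_ne_finset_zero (s := {0}) fun n hn => by
      rw [Pi.single_eq_of_ne (by simpa using hn)]
      simp
  refine ⟨Pi.single 0 ξ, Pi.single 0 ξ, hs, hs, fun x => ?_⟩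
  convert! hasSum_single (f := fun n => inner ℂ ((Pi.single 0 ξ : ℕ → H) n)
    ((x : H →L[ℂ] H) ((Pi.single 0 ξ : ℕ → H) n))) 0 (fun n hn => ?_) using 1
  rw [Pi.single_eq_of_ne hn, inner_zero_left]

theorem exp_mem {x : H →L[ℂ] H} (hx : x ∈ M) : NormedSpace.exp x ∈ M :=
  mem_of_forall_commute fun _ hg => (hg x hx).symm.exp_right

/-- If `Re ⟨e^{ith} a ξ, ξ⟩` is maximal at `t = 0` for every `ξ`, then `h` commutes with `a`. -/
theorem commute_of_re_inner_exp_le {a h : H →L[ℂ] H} (ha : IsSelfAdjoint a)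
    (hh : IsSelfAdjoint h) (hle : ∀ (t : ℝ) (ξ : H),
      (inner ℂ ξ ((NormedSpace.exp (t • Complex.I • h) * a) ξ)).re ≤ (inner ℂ ξ (a ξ)).re) :
    Commute h a := by
  have him : ∀ ξ : H, (inner ℂ ξ ((h * a) ξ)).im = 0 := by
    intro ξ
    have hd := hasDerivAt_exp_smul_const (𝕂 := ℝ) (Complex.I • h) (0 : ℝ)
    let ev : (H →L[ℂ] H) →L[ℝ] ℝ := Complex.reCLM ∘L
      ((innerSL ℂ ξ ∘L ContinuousLinearMap.apply ℂ H (a ξ)).restrictScalars ℝ)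
    have hd2 := ev.hasFDerivAt.comp_hasDerivAt (0 : ℝ) hd
    have hmax : IsLocalMax (ev ∘ fun t : ℝ => NormedSpace.exp (t • Complex.I • h)) 0 :=
      Eventually.of_forall fun t => by
        simpa [ev] using hle t ξ
    have := hmax.hasDerivAt_eq_zero hd2
    simpa [ev, inner_smul_right] using this
  -- On a complex Hilbert space a real quadratic form forces self-adjointness.
  have hsa : IsSelfAdjoint (h * a) := by
    rw [ContinuousLinearMap.isSelfAdjoint_iff_isSymmetric,
      LinearMap.isSymmetric_iff_inner_map_self_real]
    intro ξ
    rw [Complex.conj_eq_iff_im, ← inner_conj_symm, Complex.conj_im, neg_eq_zero]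
    exact him ξ
  have := hsa.star_eq
  rw [star_mul, ha.star_eq, hh.star_eq] at this
  exact this.symm

end VectorFunctional

/-! ### The two implications -/

/-- A central positive element satisfies `|φ(a)| ≤ |φ|(a)`. -/
theorem norm_map_le_of_mem_center {a : M.toStarSubalgebra} (ha : (a : H →L[ℂ] H).IsPositive)
    (hc : a ∈ Subalgebra.center ℂ M.toStarSubalgebra) {φ ψ : M.toStarSubalgebra →ₗ[ℂ] ℂ}
    {u : M.toStarSubalgebra} (h : IsPolarDecomposition φ u ψ) : (‖φ a‖ : ℂ) ≤ ψ a := by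
  obtain ⟨b, hb, hba, hcomm⟩ := exists_sqrt ha
  have hbu : b * u = u * b := hcomm u (Subalgebra.mem_center_iff.1 hc u).symm
  have hψa := Complex.nonneg_iff.1 (h.positive.map_nonneg ha)
  have h1 : φ a = ψ (star b * (u * b)) := by
    rw [h.eq_mul, hb, ← mul_assoc, hbu, mul_assoc, hba]
  have h2 := h.positive.norm_map_star_mul_sq_le b (u * b)
  -- b(1 − u*u)b is positive, since 1 − u*u is a projection.
  have h3 : (ψ (star (u * b) * (u * b))).re ≤ (ψ a).re := by
    have := h.positive.map_projection_nonneg h.isStarProjection_star_mul.one_sub b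
    rw [mul_sub, mul_one, sub_mul, map_sub, hb, hba] at this
    have h4 := (Complex.nonneg_iff.1 this).1
    rw [Complex.sub_re, sub_nonneg] at h4
    rwa [star_mul, hb, mul_assoc, ← mul_assoc (star u), ← mul_assoc]
  rw [← h1, hb, hba] at h2
  have h5 : ‖φ a‖ ≤ (ψ a).re := by
    refine (abs_le_of_sq_le_sq' (h2.trans ?_) hψa.1).2
    rw [sq]
    gcongr
    exact hψa.1
  rw [Complex.le_def]
  exact ⟨by simpa using h5, by simpa using hψa.2⟩

theorem mem_center_of_forall_selfAdjoint {a : M.toStarSubalgebra}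
    (h : ∀ y : M.toStarSubalgebra, IsSelfAdjoint y → Commute y a) :
    a ∈ Subalgebra.center ℂ M.toStarSubalgebra := by
  refine Subalgebra.mem_center_iff.2 fun y => ?_
  have h1 := h (y + star y) (IsSelfAdjoint.add_star_self y)
  have h2 := h (Complex.I • (y - star y)) (by
    rw [IsSelfAdjoint, star_smul, star_sub, star_star, Complex.star_def, Complex.conj_I, neg_smul,
      ← smul_neg, neg_sub])
  have h3 : y = (2⁻¹ : ℂ) • ((y + star y) + (-Complex.I) • (Complex.I • (y - star y))) := by
    rw [smul_smul, neg_mul, Complex.I_mul_I, neg_neg, one_smul, add_add_sub_cancel, ← two_smul ℂ,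
      smul_smul, inv_mul_cancel₀ two_ne_zero, one_smul]
  have h4 := (h1.add_left (h2.smul_left (-Complex.I))).smul_left (2⁻¹ : ℂ)
  rw [← h3] at h4
  exact h4

end VonNeumannAlgebra

open VonNeumannAlgebra in
theorem theorem2 {H : Type*} [NormedAddCommGroup H] [InnerProductSpace ℂ H] [CompleteSpace H]
    (M : VonNeumannAlgebra H) (a : M.toStarSubalgebra) (ha : (a : H →L[ℂ] H).IsPositive) :
    a ∈ Subalgebra.center ℂ M.toStarSubalgebra ↔
      ∀ φ : M.toStarSubalgebra →ₗ[ℂ] ℂ, VonNeumannAlgebra.IsNormalFunctional φ →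
        (‖φ a‖ : ℂ) ≤ VonNeumannAlgebra.absFunctional φ a := by
  refine ⟨fun hc φ hφ => ?_, fun hle => ?_⟩
  · obtain ⟨ψ, u, h⟩ := hφ.exists_isPolarDecomposition
    rw [h.absFunctional_eq]
    exact norm_map_le_of_mem_center ha hc h
  · refine mem_center_of_forall_selfAdjoint fun y hy => Subtype.ext ?_
    have hy' : IsSelfAdjoint (y : H →L[ℂ] H) := congrArg Subtype.val hy
    refine commute_of_re_inner_exp_le ha.isSelfAdjoint hy' fun t ξ => ?_
    have hty : IsSelfAdjoint (t • (y : H →L[ℂ] H)) := by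
      rw [IsSelfAdjoint, star_smul, hy'.star_eq, star_trivial]
    have hmem : t • Complex.I • (y : H →L[ℂ] H) ∈ M :=
      (((t : ℂ) • Complex.I • y : M.toStarSubalgebra)).2
    let e : M.toStarSubalgebra := ⟨NormedSpace.exp (t • Complex.I • (y : H →L[ℂ] H)), exp_mem hmem⟩
    have he : e * star e = 1 := by
      have h1 := Unitary.mul_star_self_of_mem (selfAdjoint.expUnitary ⟨_, hty⟩).2
      rw [selfAdjoint.expUnitary_coe, smul_comm] at h1
      exact Subtype.ext h1
    have hpos := isPositiveFunctional_vectorFunctional (M := M) ξ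
    have hn := isNormalFunctional_vectorFunctional (M := M) ξ
    obtain ⟨p, hp, -⟩ := hpos.exists_isSupportProjection hn
    -- The test functional ω_ξ(e ·), whose absolute value is ω_ξ because e is unitary.
    have h2 := hle _ (hn.mulLeft e)
    rw [(hpos.isPolarDecomposition_mulLeft hn hp he).absFunctional_eq] at h2
    have h3 := (Complex.le_def.1 h2).1
    rw [Complex.ofReal_re] at h3
    exact (Complex.re_le_norm _).trans h3
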